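/- Let $s>2$ and $\max\{1,s-2\}<\sigma<s-1$. Let $\psi:\mathbb R\to[0,\infty)$ be a smooth compactly supported function with $\psi=1$ on $[-2,2]$, and let $\varphi_1,\varphi_2:\mathbb R\to\mathbb R$ be smooth functions such that $\varphi_1'$ and $\varphi_2$ have compact support and $\varphi_1'=\varphi_2=1$ on $\operatorname{supp}\psi$ (the closed support). For $\delta>0$, $\omega\in\{1,-1\}$ and an integer $n\ge 1$ put $$S(x,y,t)=\psi(n^{-\delta}x)\,\psi(n^{-\delta}y)\,\sin(ny+\omega t),\qquad u_2=n^{-\delta-s-1}\partial_yS,\qquad v_2=-n^{-\delta-s-1}\partial_xS,$$ $$u_1=\omega n^{-1}\varphi_1(n^{-\delta}x)\,\varphi_2'(n^{-\delta}y),\qquad v_1=-\omega n^{-1}\varphi_1'(n^{-\delta}x)\,\varphi_2(n^{-\delta}y),$$ $$U^{\omega,n}=(0,\;u_1+u_2,\;v_1+v_2,\;0)^T .$$ For constants $\rho_0>0$, $h_0>0$, $\gamma>1$ let $$R=\partial_tU^{\omega,n}+A(U^{\omega,n})\,\partial_xU^{\omega,n}+B(U^{\omega,n})\,\partial_yU^{\omega,n}$$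 be the residual of $U^{\omega,n}$ in the two-dimensional compressible Euler system for $U=(\rho,u,v,h)^T$, where $$A(U)=\begin{pmatrix}u&\rho_0+\rho&0&0\\ \frac{h_0+h}{\rho_0+\rho}&u&0&1\\0&0&u&0\\0&(\gamma-1)(h_0+h)&0&u\end{pmatrix},\qquad B(U)=\begin{pmatrix}v&0&\rho_0+\rho&0\\0&v&0&0\\ \frac{h_0+h}{\rho_0+\rho}&0&v&1\\0&0&(\gamma-1)(h_0+h)&v\end{pmatrix}.$$ Write $\|f\|_\sigma=\big\|\mathcal F^{-1}\big((1+|\xi|^2)^{\sigma/2}\hat f\,\big)\big\|_{L^2(\mathbb R^2)}$ for the norm of $H^\sigma(\mathbb R^2)$, and $\|V\|_\sigma^2=\sum_{i=1}^4\|V_i\|_\sigma^2$ for a vector function $V$. Then there is a constant $C$, depending only on $s,\sigma,\psi,\varphi_1,\varphi_2$, such that for all $\delta>0$, $\rho_0,h_0>0$, $\gamma>1$, $\omega\in\{1,-1\}$, all integers $n\ge1$ and all $t\in\mathbb R$, the components of $R(\cdot,\cdot,t)$ belong to $H^\sigma(\mathbb R^2)$ and $$\|R(\cdot,\cdot,t)\|_\sigma\le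 C\,n^{\delta-2}.$$ -/

import Mathlib

open scoped ENNReal

noncomputable section

namespace GasDynamics

/-- The plane `ℝ²`, with its Euclidean norm; the coordinates are `p 0 = x` and `p 1 = y`. -/
abbrev Plane : Type := EuclideanSpace ℝ (Fin 2)

/-- The norm of the Bessel potential space `H^σ(ℝ²)`, `σ ≥ 0`, of a function `f`: the `L²` norm of
`Λ^σ f = 𝓕⁻¹ ((1 + |ξ|²)^(σ/2) 𝓕 f)`, where `f ∈ L²` is regarded as a tempered distribution.
The value is `⊤` exactly if `f` is not (almost everywhere equal to) an element of `H^σ`: the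
infimum is over the at most one `L²` function `g` that represents `Λ^σ f`. -/
def sobolevNorm (σ : ℝ) (f : Plane → ℂ) : ℝ≥0∞ :=
  ⨅ (T : MeasureTheory.Lp ℂ 2 (MeasureTheory.volume : MeasureTheory.Measure Plane))
    (_ : f =ᵐ[MeasureTheory.volume] T)
    (g : MeasureTheory.Lp ℂ 2 (MeasureTheory.volume : MeasureTheory.Measure Plane))
    (_ : TemperedDistribution.besselPotential Plane ℂ σ
          (MeasureTheory.Lp.toTemperedDistribution T) =
        MeasureTheory.Lp.toTemperedDistribution g),
    ‖g‖ₑ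

/-- `‖V‖_σ = (‖V₁‖_σ² + ‖V₂‖_σ² + ‖V₃‖_σ² + ‖V₄‖_σ²)^(1/2)` for a vector function
`V(x, y) ∈ ℝ⁴`. -/
def sobolevNormVec (σ : ℝ) (V : ℝ → ℝ → Fin 4 → ℝ) : ℝ≥0∞ :=
  (∑ i : Fin 4, sobolevNorm σ (fun p : Plane => ((V (p 0) (p 1) i : ℝ) : ℂ)) ^ 2) ^ (1 / 2 : ℝ)

/-- The coefficient matrix `A(U)` of `U_x`, with `U = (ρ, u, v, h)`. -/
def matA (ρ₀ h₀ γ : ℝ) (U : Fin 4 → ℝ) : Matrix (Fin 4) (Fin 4) ℝ :=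
  !![U 1, ρ₀ + U 0, 0, 0;
     (h₀ + U 3) / (ρ₀ + U 0), U 1, 0, 1;
     0, 0, U 1, 0;
     0, (γ - 1) * (h₀ + U 3), 0, U 1]

/-- The coefficient matrix `B(U)` of `U_y`, with `U = (ρ, u, v, h)`. -/
def matB (ρ₀ h₀ γ : ℝ) (U : Fin 4 → ℝ) : Matrix (Fin 4) (Fin 4) ℝ :=
  !![U 2, 0, ρ₀ + U 0, 0;
     0, U 2, 0, 0;
     (h₀ + U 3) / (ρ₀ + U 0), 0, U 2, 1;
     0, 0, (γ - 1) * (h₀ + U 3), U 2]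

/-- The residual `U_t + A(U) U_x + B(U) U_y` of the compressible Euler system at a state
`U(t, x, y) = (ρ, u, v, h)`. -/
def eulerResidual (ρ₀ h₀ γ : ℝ) (U : ℝ → ℝ → ℝ → Fin 4 → ℝ) (t x y : ℝ) : Fin 4 → ℝ :=
  deriv (fun t' => U t' x y) t
    + (matA ρ₀ h₀ γ (U t x y)).mulVec (deriv (fun x' => U t x' y) x)
    + (matB ρ₀ h₀ γ (U t x y)).mulVec (deriv (fun y' => U t x y') y)

/-- The stream function `S(x, y, t) = ψ(n^(-δ) x) ψ(n^(-δ) y) sin(n y + ω t)`. -/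
def streamS (ψ : ℝ → ℝ) (δ ω : ℝ) (n : ℕ) (t x y : ℝ) : ℝ :=
  ψ ((n : ℝ) ^ (-δ) * x) * ψ ((n : ℝ) ^ (-δ) * y) * Real.sin (n * y + ω * t)

/-- High frequency velocity, first component: `n^(-δ-s-1) ∂_y S`. -/
def uHigh (ψ : ℝ → ℝ) (s δ ω : ℝ) (n : ℕ) (t x y : ℝ) : ℝ :=
  (n : ℝ) ^ (-δ - s - 1) * deriv (fun y' => streamS ψ δ ω n t x y') y

/-- High frequency velocity, second component: `-n^(-δ-s-1) ∂_x S`. -/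
def vHigh (ψ : ℝ → ℝ) (s δ ω : ℝ) (n : ℕ) (t x y : ℝ) : ℝ :=
  -(n : ℝ) ^ (-δ - s - 1) * deriv (fun x' => streamS ψ δ ω n t x' y) x

/-- Low frequency velocity, first component: `ω n^(-1) φ₁(n^(-δ) x) φ₂'(n^(-δ) y)`. -/
def uLow (φ₁ φ₂ : ℝ → ℝ) (δ ω : ℝ) (n : ℕ) (x y : ℝ) : ℝ :=
  ω * (n : ℝ)⁻¹ * φ₁ ((n : ℝ) ^ (-δ) * x) * deriv φ₂ ((n : ℝ) ^ (-δ) * y)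

/-- Low frequency velocity, second component: `-ω n^(-1) φ₁'(n^(-δ) x) φ₂(n^(-δ) y)`. -/
def vLow (φ₁ φ₂ : ℝ → ℝ) (δ ω : ℝ) (n : ℕ) (x y : ℝ) : ℝ :=
  -ω * (n : ℝ)⁻¹ * deriv φ₁ ((n : ℝ) ^ (-δ) * x) * φ₂ ((n : ℝ) ^ (-δ) * y)

/-- The approximate solution `U^{ω,n} = (0, u₁ + u₂, v₁ + v₂, 0)`. -/
def approxSol (ψ φ₁ φ₂ : ℝ → ℝ) (s δ ω : ℝ) (n : ℕ) (t x y : ℝ) : Fin 4 → ℝ :=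
  ![0,
    uLow φ₁ φ₂ δ ω n x y + uHigh ψ s δ ω n t x y,
    vLow φ₁ φ₂ δ ω n x y + vHigh ψ s δ ω n t x y,
    0]

/-- The requirements on the cutoff functions: `ψ ≥ 0` is smooth with compact support and equals
one on `[-2, 2]`; `φ₁` is smooth, `φ₁'` and `φ₂` are smooth with compact support, and both equal
one on the (closed) support of `ψ`. -/
structure IsCutoffTriple (ψ φ₁ φ₂ : ℝ → ℝ) : Prop where
  psi_smooth : ContDiff ℝ (⊤ : ℕ∞) ψ
  psi_compact : HasCompactSupport ψ
  psi_nonneg : ∀ x, 0 ≤ ψ x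
  psi_one : ∀ x ∈ Set.Icc (-2 : ℝ) 2, ψ x = 1
  phi_one_smooth : ContDiff ℝ (⊤ : ℕ∞) φ₁
  phi_one_compact : HasCompactSupport (deriv φ₁)
  phi_two_smooth : ContDiff ℝ (⊤ : ℕ∞) φ₂
  phi_two_compact : HasCompactSupport φ₂
  phi_one_eq : ∀ x ∈ tsupport ψ, deriv φ₁ x = 1
  phi_two_eq : ∀ x ∈ tsupport ψ, φ₂ x = 1

end GasDynamics

end

/-! Write `ε = n^(-δ)`, `m = 1/n`, `q = n^(-s-1)`. Both velocities come from stream functions, so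
the divergence vanishes, and with `ρ = h = 0` the first and last residual components are multiples
of it. On the support of `ψ` the low frequency velocity is the constant `(0, -ω/n)`. It transports
the phase `n y + ω t` exactly, so the leading part `-ω a n ψψ sin` of `∂_t u₂` (`a = ε q`) cancels
against `v₁ ∂_y u₂`, and of the cross terms only derivatives falling on the cutoffs survive. This is
`eulerResidual_approxSol`.

What remains is a finite sum of terms `c F(εx) G(εy) cos(κy + θ)` with fixed test functions `F`, `G`
and `|κ| ≤ 2n`. In `H^σ` such a term is `O(|c| ε⁻¹ (1 + |κ|)^σ)`
(`exists_hasSobolevBound_tensor_cos`): the dilation costs `ε⁻¹` in two dimensions and the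
oscillation costs `(1 + |κ|)^σ`. The low frequency self-interaction has `c = m² ε`, and every other
term has `|c| ≤ ε q`, where `q n^σ ≤ n⁻²` because `σ < s - 1`. Hence each term is `O(n⁻²)`, which is
at most `O(n^(δ-2))`. -/

noncomputable section

namespace GasDynamics

open MeasureTheory FourierTransform
open scoped SchwartzMap

/-! ### Sobolev norms of Schwartz functions -/

/-- The weight `(1 + |ξ|²)^(σ/2)` of the Bessel potential of order `σ`. -/
def besselWeight (σ : ℝ) (ξ : Plane) : ℝ := (1 + ‖ξ‖ ^ 2) ^ (σ / 2)

theorem besselWeight_hasTemperateGrowth (σ : ℝ) :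
    (fun ξ => (besselWeight σ ξ : ℂ)).HasTemperateGrowth := by
  unfold besselWeight
  fun_prop

/-- The Bessel potential of a Schwartz function, as an element of `L²`. -/
def besselLp (σ : ℝ) : 𝓢(Plane, ℂ) →L[ℂ] Lp ℂ 2 (volume : Measure Plane) :=
  SchwartzMap.toLpCLM ℂ ℂ 2 volume ∘L
    SchwartzMap.fourierMultiplierCLM ℂ (fun ξ => (besselWeight σ ξ : ℂ))

theorem besselLp_apply (σ : ℝ) (f : 𝓢(Plane, ℂ)) :
    besselLp σ f =
      (SchwartzMap.fourierMultiplierCLM ℂ (fun ξ => (besselWeight σ ξ : ℂ)) f).toLp 2 := rfl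

/-- The multiplier on tempered distributions extends the one on Schwartz functions, so `besselLp σ
f` is admissible in the infimum. Only this inequality is needed. -/
theorem sobolevNorm_le_of_schwartz (σ : ℝ) (f : 𝓢(Plane, ℂ)) :
    sobolevNorm σ f ≤ ‖besselLp σ f‖ₑ := by
  refine iInf_le_of_le (f.toLp 2) (iInf_le_of_le (f.coeFn_toLp 2 volume).symm
    (iInf_le_of_le (besselLp σ f) (iInf_le_of_le ?_ le_rfl)))
  rw [besselLp_apply, TemperedDistribution.besselPotential,
    Lp.toTemperedDistribution_toLp_eq, Lp.toTemperedDistribution_toLp_eq,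
    TemperedDistribution.fourierMultiplierCLM_toTemperedDistributionCLM_eq (by fun_prop)]
  rfl

/-- Plancherel's identity for the Bessel potential of a Schwartz function. -/
theorem enorm_besselLp (σ : ℝ) (f : 𝓢(Plane, ℂ)) :
    ‖besselLp σ f‖ₑ = eLpNorm (fun ξ => (besselWeight σ ξ : ℂ) * 𝓕 f ξ) 2 volume := by
  have h : ‖besselLp σ f‖ =
      ‖(SchwartzMap.smulLeftCLM ℂ (fun ξ => (besselWeight σ ξ : ℂ)) (𝓕 f)).toLp 2‖ := by
    rw [besselLp_apply, ← SchwartzMap.norm_fourier_toL2_eq,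
      SchwartzMap.fourierMultiplierCLM_apply, fourier_fourierInv_eq]
  rw [← ofReal_norm, h, ofReal_norm, Lp.enorm_def]
  refine eLpNorm_congr_ae ((SchwartzMap.coeFn_toLp _ 2 volume).trans (ae_of_all _ fun ξ => ?_))
  simp [SchwartzMap.smulLeftCLM_apply_apply (besselWeight_hasTemperateGrowth σ)]

/-! ### Wave packets in Fourier space -/

theorem besselWeight_nonneg (σ : ℝ) (ξ : Plane) : 0 ≤ besselWeight σ ξ := by
  unfold besselWeight; positivity

/-- A Peetre-type inequality. Since `ε ≤ 1`, contracting `ξ` does not increase the weight, so the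
bound is uniform in `ε`. -/
theorem besselWeight_add_smul_le {σ ε : ℝ} (hσ : 0 ≤ σ) (hε : 0 < ε) (hε1 : ε ≤ 1)
    (ξ ζ : Plane) :
    besselWeight σ (ζ + ε • ξ) ≤ 2 ^ σ * (1 + ‖ζ‖) ^ σ * besselWeight σ ξ := by
  have h1 : ‖ζ + ε • ξ‖ ≤ ‖ζ‖ + ‖ξ‖ := by
    refine (norm_add_le _ _).trans ?_
    rw [norm_smul, Real.norm_of_nonneg hε.le]
    nlinarith [norm_nonneg ξ]
  have h2 : 1 + ‖ζ + ε • ξ‖ ^ 2 ≤ (2 * (1 + ‖ζ‖)) ^ 2 * (1 + ‖ξ‖ ^ 2) := by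
    have h3 : ‖ζ + ε • ξ‖ ^ 2 ≤ (‖ζ‖ + ‖ξ‖) ^ 2 := by gcongr
    nlinarith [sq_nonneg (‖ζ‖ - ‖ξ‖), norm_nonneg ξ, norm_nonneg ζ,
      mul_nonneg (norm_nonneg ζ) (sq_nonneg ‖ξ‖), mul_nonneg (sq_nonneg ‖ζ‖) (sq_nonneg ‖ξ‖)]
  unfold besselWeight
  calc (1 + ‖ζ + ε • ξ‖ ^ 2) ^ (σ / 2)
      ≤ ((2 * (1 + ‖ζ‖)) ^ 2 * (1 + ‖ξ‖ ^ 2)) ^ (σ / 2) := by gcongr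
    _ = _ := by
      rw [Real.mul_rpow (by positivity) (by positivity), ← Real.rpow_natCast,
        ← Real.rpow_mul (by positivity), ← Real.mul_rpow (by positivity) (by positivity)]
      congr 2
      push_cast
      ring

/-- The Fourier transform of a dilated and modulated function. -/
theorem fourier_wavePacket (g : Plane → ℂ) {ε : ℝ} (hε : 0 < ε) (ζ ξ : Plane) (c : ℂ) :
    𝓕 (fun v : Plane => c * g (ε • v) * Complex.exp ((2 * Real.pi * inner ℝ v ζ : ℝ) * Complex.I)) ξ
      = c * ((ε ^ 2)⁻¹ : ℝ) * 𝓕 g (ε⁻¹ • (ξ - ζ)) := by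
  let Φ : Plane → ℂ := fun w =>
    c * (Complex.exp ((-2 * Real.pi * inner ℝ w (ε⁻¹ • (ξ - ζ)) : ℝ) * Complex.I) • g w)
  have hint : ∀ v : Plane, Complex.exp ((-2 * Real.pi * inner ℝ v ξ : ℝ) * Complex.I) •
      (c * g (ε • v) * Complex.exp ((2 * Real.pi * inner ℝ v ζ : ℝ) * Complex.I))
      = Φ (ε • v) := by
    intro v
    have : Complex.exp ((-2 * Real.pi * inner ℝ (ε • v) (ε⁻¹ • (ξ - ζ)) : ℝ) * Complex.I)
        = Complex.exp ((-2 * Real.pi * inner ℝ v ξ : ℝ) * Complex.I)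
          * Complex.exp ((2 * Real.pi * inner ℝ v ζ : ℝ) * Complex.I) := by
      rw [← Complex.exp_add]
      congr 1
      rw [inner_smul_left, inner_smul_right, inner_sub_right]
      have : (starRingEnd ℝ) ε * (ε⁻¹ * (inner ℝ v ξ - inner ℝ v ζ))
          = inner ℝ v ξ - inner ℝ v ζ := by
        simp only [conj_trivial]; field_simp
      rw [this]
      push_cast
      ring
    simp only [Φ, this, smul_eq_mul]
    ring
  rw [Real.fourier_eq', Real.fourier_eq', integral_congr_ae (ae_of_all _ hint),
    Measure.integral_comp_smul volume Φ ε, integral_const_mul]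
  simp only [finrank_euclideanSpace, Fintype.card_fin, Complex.real_smul]
  rw [abs_of_pos (by positivity)]
  ring

theorem eLpNorm_comp_dilation (G : Plane → ℂ) (hG : Continuous G) {ε : ℝ} (hε : 0 < ε)
    (ζ : Plane) :
    eLpNorm (fun ξ => G (ε⁻¹ • (ξ - ζ))) 2 volume = ENNReal.ofReal ε * eLpNorm G 2 volume := by
  have h1 : eLpNorm (fun ξ => G (ε⁻¹ • (ξ - ζ))) 2 volume
      = eLpNorm (fun ξ => G (ε⁻¹ • ξ)) 2 volume :=
    eLpNorm_comp_measurePreserving (g := fun ξ => G (ε⁻¹ • ξ))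
      (by fun_prop) (measurePreserving_sub_right volume ζ)
  have h2 : eLpNorm (fun ξ => G (ε⁻¹ • ξ)) 2 volume
      = eLpNorm G 2 (Measure.map (fun ξ : Plane => ε⁻¹ • ξ) volume) :=
    (eLpNorm_map_measure (by fun_prop) (by fun_prop)).symm
  rw [h1, h2, Measure.map_addHaar_smul volume (inv_ne_zero hε.ne'),
    eLpNorm_smul_measure_of_ne_top (by norm_num), smul_eq_mul]
  congr 1
  simp only [finrank_euclideanSpace, Fintype.card_fin]
  rw [inv_pow, inv_inv, abs_of_pos (by positivity),
    ENNReal.ofReal_rpow_of_pos (by positivity)]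
  congr 1
  rw [← Real.rpow_natCast, ← Real.rpow_mul hε.le]
  norm_num

/-- The transform of the packet is that of `g`, shrunk to scale `ε` around `ζ` with amplitude `ε⁻²`.
Rescaling in `L²` gives back a factor `ε`, and the Peetre inequality moves the weight from `ζ` to
the origin. -/
theorem norm_besselLp_wavePacket_le {σ ε : ℝ} (hσ : 0 ≤ σ) (hε : 0 < ε) (hε1 : ε ≤ 1)
    (g f : 𝓢(Plane, ℂ)) (ζ : Plane) (c : ℂ)
    (hf : ∀ v, f v = c * g (ε • v) *
      Complex.exp ((2 * Real.pi * inner ℝ v ζ : ℝ) * Complex.I)) :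
    ‖besselLp σ f‖ ≤ ‖c‖ * (2 ^ σ * (1 + ‖ζ‖) ^ σ) * ε⁻¹ * ‖besselLp σ g‖ := by
  have hF : ∀ ξ, 𝓕 f ξ = c * ((ε ^ 2)⁻¹ : ℝ) * 𝓕 g (ε⁻¹ • (ξ - ζ)) := by
    intro ξ
    rw [SchwartzMap.fourier_coe, SchwartzMap.fourier_coe, ← fourier_wavePacket g hε ζ ξ c,
      show (f : Plane → ℂ) = _ from funext hf]
  set A : ℝ := ‖c‖ * (ε ^ 2)⁻¹ * (2 ^ σ * (1 + ‖ζ‖) ^ σ) with hA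
  have hA0 : 0 ≤ A := by positivity
  have hcont : Continuous fun ξ => (besselWeight σ ξ : ℂ) * 𝓕 g ξ :=
    (besselWeight_hasTemperateGrowth σ).1.continuous.mul (𝓕 g).continuous
  have key : ‖besselLp σ f‖ₑ ≤ ENNReal.ofReal (A * ε) * ‖besselLp σ g‖ₑ := by
    rw [enorm_besselLp, enorm_besselLp, ENNReal.ofReal_mul hA0, mul_assoc,
      ← eLpNorm_comp_dilation _ hcont hε ζ]
    refine eLpNorm_le_mul_eLpNorm_of_ae_le_mul (ae_of_all _ fun ξ => ?_) 2
    have hw := besselWeight_add_smul_le hσ hε hε1 (ε⁻¹ • (ξ - ζ)) ζ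
    rw [smul_smul, mul_inv_cancel₀ hε.ne', one_smul, add_sub_cancel] at hw
    rw [hF]
    simp only [norm_mul, Complex.norm_real, Real.norm_of_nonneg (besselWeight_nonneg _ _)]
    rw [Real.norm_of_nonneg (by positivity : (0 : ℝ) ≤ (ε ^ 2)⁻¹)]
    calc _ ≤ (2 ^ σ * (1 + ‖ζ‖) ^ σ * besselWeight σ (ε⁻¹ • (ξ - ζ))) *
          (‖c‖ * (ε ^ 2)⁻¹ * ‖𝓕 g (ε⁻¹ • (ξ - ζ))‖) := by gcongr
      _ = _ := by rw [hA]; ring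
  rw [← ofReal_norm, ← ofReal_norm, ← ENNReal.ofReal_mul (by positivity),
    ENNReal.ofReal_le_ofReal_iff (by positivity)] at key
  refine key.trans_eq ?_
  rw [hA]
  field_simp

/-! ### Calculus of Sobolev bounds and modulated product profiles -/

/-- `f` agrees with a Schwartz function whose norm in `H^σ` is at most `C`. -/
def HasSobolevBound (σ : ℝ) (f : Plane → ℂ) (C : ℝ) : Prop :=
  ∃ F : 𝓢(Plane, ℂ), (∀ v, F v = f v) ∧ ‖besselLp σ F‖ ≤ C

theorem HasSobolevBound.sobolevNorm_le {σ C : ℝ} {f : Plane → ℂ} (h : HasSobolevBound σ f C) :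
    sobolevNorm σ f ≤ ENNReal.ofReal C := by
  obtain ⟨F, hF, hC⟩ := h
  obtain rfl : (F : Plane → ℂ) = f := funext hF
  refine (sobolevNorm_le_of_schwartz σ F).trans ?_
  rw [← ofReal_norm]
  exact ENNReal.ofReal_le_ofReal hC

theorem HasSobolevBound.add {σ C D : ℝ} {f g : Plane → ℂ} (hf : HasSobolevBound σ f C)
    (hg : HasSobolevBound σ g D) : HasSobolevBound σ (fun v => f v + g v) (C + D) := by
  obtain ⟨F, hF, hC⟩ := hf
  obtain ⟨G, hG, hD⟩ := hg
  refine ⟨F + G, fun v => by simp [hF, hG], ?_⟩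
  rw [map_add]
  exact (norm_add_le _ _).trans (add_le_add hC hD)

theorem HasSobolevBound.const_mul {σ C D : ℝ} {f : Plane → ℂ} (hf : HasSobolevBound σ f C)
    (a : ℂ) (ha : ‖a‖ * C ≤ D) : HasSobolevBound σ (fun v => a * f v) D := by
  obtain ⟨F, hF, hC⟩ := hf
  refine ⟨a • F, fun v => by simp [hF], ?_⟩
  rw [map_smul, norm_smul]
  exact (mul_le_mul_of_nonneg_left hC (norm_nonneg a)).trans ha

theorem hasSobolevBound_zero (σ : ℝ) : HasSobolevBound σ (fun _ => 0) 0 :=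
  ⟨0, by simp, by simp⟩

theorem hasCompactSupport_tensor {F G : ℝ → ℝ} (hFc : HasCompactSupport F)
    (hGc : HasCompactSupport G) :
    HasCompactSupport fun v : Plane => ((F (v 0) * G (v 1) : ℝ) : ℂ) := by
  have hK : IsCompact ((EuclideanSpace.equiv (Fin 2) ℝ).symm ''
      (Set.univ.pi ![tsupport F, tsupport G])) := by
    refine (isCompact_univ_pi fun i => ?_).image (EuclideanSpace.equiv (Fin 2) ℝ).symm.continuous
    fin_cases i
    · exact hFc
    · exact hGc
  refine HasCompactSupport.intro hK fun v hv => ?_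
  by_contra h
  refine hv ⟨EuclideanSpace.equiv (Fin 2) ℝ v, fun i _ => ?_, by simp⟩
  have h' : F (v 0) * G (v 1) ≠ 0 := by exact_mod_cast h
  fin_cases i
  · exact subset_tsupport _ (left_ne_zero_of_mul h')
  · exact subset_tsupport _ (right_ne_zero_of_mul h')

theorem HasSobolevBound.wavePacket {σ ε : ℝ} (hσ : 0 ≤ σ) (hε : 0 < ε) (hε1 : ε ≤ 1)
    {g : Plane → ℂ} {K : ℝ} (hg : ContDiff ℝ (⊤ : ℕ∞) g) (hgc : HasCompactSupport g)
    (hK : HasSobolevBound σ g K) (ζ : Plane) (c : ℂ) :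
    HasSobolevBound σ (fun v => c * g (ε • v) *
      Complex.exp ((2 * Real.pi * inner ℝ v ζ : ℝ) * Complex.I))
      (‖c‖ * (2 ^ σ * (1 + ‖ζ‖) ^ σ) * ε⁻¹ * K) := by
  obtain ⟨G, hG, hGK⟩ := hK
  obtain rfl : (G : Plane → ℂ) = g := funext hG
  have hs : ContDiff ℝ (⊤ : ℕ∞) (fun v : Plane => c * G (ε • v) *
      Complex.exp ((2 * Real.pi * inner ℝ v ζ : ℝ) * Complex.I)) := by
    refine (contDiff_const.mul (hg.comp (contDiff_const_smul ε))).mul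
      (Complex.contDiff_exp.comp (ContDiff.mul ?_ contDiff_const))
    exact Complex.ofRealCLM.contDiff.comp
      (contDiff_const.mul (contDiff_id.inner ℝ contDiff_const))
  have hc : HasCompactSupport (fun v : Plane => c * G (ε • v) *
      Complex.exp ((2 * Real.pi * inner ℝ v ζ : ℝ) * Complex.I)) :=
    ((hgc.comp_smul hε.ne').mul_left).mul_right
  refine ⟨hc.toSchwartzMap hs, fun v => rfl, ?_⟩
  refine (norm_besselLp_wavePacket_le hσ hε hε1 G (hc.toSchwartzMap hs) ζ c fun v => rfl).trans ?_
  gcongr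

/-- A dilated product profile times a plane wave in the second variable has norm
`O(ε⁻¹ (1 + |κ|)^σ)` in `H^σ`, uniformly in the dilation `ε ≤ 1`, the frequency `κ` and the
phase `θ`. -/
theorem exists_hasSobolevBound_tensor_cos {σ : ℝ} (hσ : 0 ≤ σ) {F G : ℝ → ℝ}
    (hF : ContDiff ℝ (⊤ : ℕ∞) F) (hFc : HasCompactSupport F) (hG : ContDiff ℝ (⊤ : ℕ∞) G)
    (hGc : HasCompactSupport G) :
    ∃ K : ℝ, 0 ≤ K ∧ ∀ ε κ θ : ℝ, 0 < ε → ε ≤ 1 →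
      HasSobolevBound σ
        (fun p => ((F (ε * p 0) * G (ε * p 1) * Real.cos (κ * p 1 + θ) : ℝ) : ℂ))
        (K * ε⁻¹ * (1 + |κ|) ^ σ) := by
  set g : Plane → ℂ := fun v => ((F (v 0) * G (v 1) : ℝ) : ℂ) with hgdef
  have hg : ContDiff ℝ (⊤ : ℕ∞) g := by
    refine Complex.ofRealCLM.contDiff.comp ((hF.comp ?_).mul (hG.comp ?_))
    · exact (EuclideanSpace.proj (𝕜 := ℝ) (0 : Fin 2)).contDiff
    · exact (EuclideanSpace.proj (𝕜 := ℝ) (1 : Fin 2)).contDiff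
  have hgc : HasCompactSupport g := hasCompactSupport_tensor hFc hGc
  have hgb : HasSobolevBound σ g ‖besselLp σ (hgc.toSchwartzMap hg)‖ :=
    ⟨hgc.toSchwartzMap hg, fun v => rfl, le_rfl⟩
  set K₀ := ‖besselLp σ (hgc.toSchwartzMap hg)‖
  have hK₀ : 0 ≤ K₀ := norm_nonneg _
  refine ⟨2 ^ σ * K₀, by positivity, fun ε κ θ hε hε1 => ?_⟩
  -- The Fourier character is `exp (2πi⟨v, ζ⟩)`, hence the division by `2π`. The cosine is then half
  -- the sum of the packets at `ζ κ` and `ζ (-κ)`.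
  set ζ : ℝ → Plane := fun k => EuclideanSpace.single 1 (k / (2 * Real.pi)) with hζ
  have hζn : ∀ k : ℝ, ‖ζ k‖ ≤ |k| := fun k => by
    rw [hζ, PiLp.norm_single, Real.norm_eq_abs, abs_div]
    refine div_le_self (abs_nonneg _) ?_
    rw [abs_of_pos (by positivity)]
    linarith [Real.pi_gt_three]
  have hζi : ∀ (k : ℝ) (v : Plane), 2 * Real.pi * inner ℝ v (ζ k) = k * v 1 := fun k v => by
    simp only [hζ, EuclideanSpace.inner_single_right, conj_trivial]
    field_simp
  have hw : ∀ k φ : ℝ, HasSobolevBound σ (fun v => ((1 / 2 : ℂ) * Complex.exp (φ * Complex.I)) *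
      g (ε • v) * Complex.exp ((2 * Real.pi * inner ℝ v (ζ k) : ℝ) * Complex.I))
      (1 / 2 * (2 ^ σ * (1 + ‖ζ k‖) ^ σ) * ε⁻¹ * K₀) := fun k φ => by
    have := hgb.wavePacket hσ hε hε1 hg hgc (ζ k) ((1 / 2 : ℂ) * Complex.exp (φ * Complex.I))
    rwa [norm_mul, Complex.norm_exp_ofReal_mul_I, mul_one,
      show ‖(1 / 2 : ℂ)‖ = 1 / 2 by norm_num] at this
  obtain ⟨H, hH, hHC⟩ := (hw κ θ).add (hw (-κ) (-θ))
  refine ⟨H, fun v => ?_, hHC.trans ?_⟩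
  · rw [hH]
    simp only [hζi, hgdef, PiLp.smul_apply, smul_eq_mul]
    push_cast
    rw [Complex.cos, show (((κ : ℂ) * (v 1 : ℂ) + (θ : ℂ)) * Complex.I)
        = θ * Complex.I + κ * v 1 * Complex.I by ring, Complex.exp_add,
      show (-((κ : ℂ) * (v 1 : ℂ) + (θ : ℂ)) * Complex.I)
        = -θ * Complex.I + -κ * v 1 * Complex.I by ring, Complex.exp_add]
    ring
  · have h1 : (1 + ‖ζ κ‖) ^ σ ≤ (1 + |κ|) ^ σ := by gcongr; exact hζn κ
    have h2 : (1 + ‖ζ (-κ)‖) ^ σ ≤ (1 + |κ|) ^ σ := by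
      gcongr; exact (hζn (-κ)).trans_eq (abs_neg κ)
    calc _ ≤ 1 / 2 * (2 ^ σ * (1 + |κ|) ^ σ) * ε⁻¹ * K₀
          + 1 / 2 * (2 ^ σ * (1 + |κ|) ^ σ) * ε⁻¹ * K₀ := by gcongr
      _ = _ := by ring

/-! ### Pointwise computation of the residual -/

theorem hasDerivAt_velocity {f g : ℝ → ℝ} {f' g' x : ℝ} (hf : HasDerivAt f f' x)
    (hg : HasDerivAt g g' x) :
    HasDerivAt (fun x => (![0, f x, g x, 0] : Fin 4 → ℝ)) ![0, f', g', 0] x := by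
  rw [hasDerivAt_pi]
  intro i
  fin_cases i
  · exact hasDerivAt_const x 0
  · exact hf
  · exact hg
  · exact hasDerivAt_const x 0

/-- The residual of a state with vanishing `ρ` and `h` components. -/
theorem eulerResidual_velocity (ρ₀ h₀ γ : ℝ) {u v : ℝ → ℝ → ℝ → ℝ} {t x y ut ux uy vt vx vy : ℝ}
    (hut : HasDerivAt (fun t' => u t' x y) ut t) (hux : HasDerivAt (fun x' => u t x' y) ux x)
    (huy : HasDerivAt (fun y' => u t x y') uy y) (hvt : HasDerivAt (fun t' => v t' x y) vt t)
    (hvx : HasDerivAt (fun x' => v t x' y) vx x) (hvy : HasDerivAt (fun y' => v t x y') vy y) :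
    eulerResidual ρ₀ h₀ γ (fun t x y => ![0, u t x y, v t x y, 0]) t x y =
      ![ρ₀ * (ux + vy), ut + u t x y * ux + v t x y * uy, vt + u t x y * vx + v t x y * vy,
        (γ - 1) * h₀ * (ux + vy)] := by
  rw [eulerResidual, (hasDerivAt_velocity hut hvt).deriv, (hasDerivAt_velocity hux hvx).deriv,
    (hasDerivAt_velocity huy hvy).deriv]
  ext i
  simp only [Pi.add_apply, Matrix.mulVec, dotProduct, Fin.sum_univ_four]
  fin_cases i <;> simp [matA, matB] <;> ring

/-- On the open set `ψ ≠ 0` the function is locally constant; continuity of its derivative carries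
the vanishing to the closure, whose boundary points need not be interior. -/
theorem deriv_eq_zero_of_eq_const_on_tsupport {ψ g : ℝ → ℝ} {c : ℝ} (hψ : Continuous ψ)
    (hg : ContDiff ℝ (⊤ : ℕ∞) g) (h : ∀ x ∈ tsupport ψ, g x = c) : ∀ x ∈ tsupport ψ, deriv g x = 0 := by
  have hcl : IsClosed {x | deriv g x = 0} :=
    isClosed_eq (hg.continuous_deriv (by simp)) continuous_const
  refine closure_minimal (fun x hx => ?_) hcl
  have hev : g =ᶠ[nhds x] fun _ => c := by
    filter_upwards [(hψ.isOpen_support).mem_nhds hx] with z hz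
    exact h z (subset_tsupport _ hz)
  change deriv g x = 0
  rw [hev.deriv_eq, deriv_const]

theorem contDiff_deriv {f : ℝ → ℝ} (hf : ContDiff ℝ (⊤ : ℕ∞) f) : ContDiff ℝ (⊤ : ℕ∞) (deriv f) :=
  (contDiff_infty_iff_deriv.mp hf).2

theorem hasDerivAt_comp_const_mul {f : ℝ → ℝ} (hf : ContDiff ℝ (⊤ : ℕ∞) f) (ε x : ℝ) :
    HasDerivAt (fun x => f (ε * x)) (ε * deriv f (ε * x)) x := by
  have h1 : HasDerivAt f (deriv f (ε * x)) (ε * x) :=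
    (hf.differentiable (by simp)).differentiableAt.hasDerivAt
  have h2 : HasDerivAt (fun x => ε * x) ε x := by
    simpa using (hasDerivAt_id x).const_mul ε
  exact (h1.comp x h2).congr_deriv (by ring)

theorem hasDerivAt_sin_phase (N θ y : ℝ) :
    HasDerivAt (fun y => Real.sin (N * y + θ)) (N * Real.cos (N * y + θ)) y := by
  have h : HasDerivAt (fun y => N * y + θ) N y := by
    simpa using ((hasDerivAt_id y).const_mul N).add_const θ
  exact h.sin.congr_deriv (by ring)

theorem hasDerivAt_cos_phase (N θ y : ℝ) :
    HasDerivAt (fun y => Real.cos (N * y + θ)) (-N * Real.sin (N * y + θ)) y := by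
  have h : HasDerivAt (fun y => N * y + θ) N y := by
    simpa using ((hasDerivAt_id y).const_mul N).add_const θ
  exact h.cos.congr_deriv (by ring)

theorem hasDerivAt_sin_phase_add (θ ω t : ℝ) :
    HasDerivAt (fun t => Real.sin (θ + ω * t)) (ω * Real.cos (θ + ω * t)) t := by
  simpa only [add_comm] using hasDerivAt_sin_phase ω θ t

theorem hasDerivAt_cos_phase_add (θ ω t : ℝ) :
    HasDerivAt (fun t => Real.cos (θ + ω * t)) (-ω * Real.sin (θ + ω * t)) t := by
  simpa only [add_comm] using hasDerivAt_cos_phase ω θ t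

section Residual

variable {ψ φ₁ φ₂ : ℝ → ℝ}

theorem uHigh_eq (hψ : ContDiff ℝ (⊤ : ℕ∞) ψ) (s δ ω : ℝ) (n : ℕ) (t x y : ℝ) :
    uHigh ψ s δ ω n t x y = (n : ℝ) ^ (-δ - s - 1) *
      (n * (ψ ((n : ℝ) ^ (-δ) * x) * ψ ((n : ℝ) ^ (-δ) * y) * Real.cos (n * y + ω * t)) +
        (n : ℝ) ^ (-δ) * (ψ ((n : ℝ) ^ (-δ) * x) * deriv ψ ((n : ℝ) ^ (-δ) * y) *
          Real.sin (n * y + ω * t))) := by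
  unfold uHigh streamS
  have h := ((hasDerivAt_comp_const_mul hψ ((n : ℝ) ^ (-δ)) y).const_mul
    (ψ ((n : ℝ) ^ (-δ) * x))).fun_mul (hasDerivAt_sin_phase n (ω * t) y)
  rw [show deriv _ y = _ from h.deriv]
  ring

theorem vHigh_eq (hψ : ContDiff ℝ (⊤ : ℕ∞) ψ) (s δ ω : ℝ) (n : ℕ) (t x y : ℝ) :
    vHigh ψ s δ ω n t x y = -(n : ℝ) ^ (-δ - s - 1) * ((n : ℝ) ^ (-δ) *
      (deriv ψ ((n : ℝ) ^ (-δ) * x) * ψ ((n : ℝ) ^ (-δ) * y) * Real.sin (n * y + ω * t))) := by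
  unfold vHigh streamS
  have h := ((hasDerivAt_comp_const_mul hψ ((n : ℝ) ^ (-δ)) x).mul_const
    (ψ ((n : ℝ) ^ (-δ) * y))).mul_const (Real.sin (n * y + ω * t))
  rw [show deriv _ x = _ from h.deriv]
  ring

/-- The residual consists of the self-interaction of the low frequency part, of the error of the
transport of the high frequency part along the constant low frequency velocity, and of the
self-interaction of the high frequency part. -/
theorem eulerResidual_approxSol (hcut : IsCutoffTriple ψ φ₁ φ₂) (s δ ρ₀ h₀ γ : ℝ) {ω : ℝ}
    (hω : ω = 1 ∨ ω = -1) {n : ℕ} (hn : 1 ≤ n) {ε a X Y θ : ℝ} (t x y : ℝ)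
    (hε : (n : ℝ) ^ (-δ) = ε) (ha : (n : ℝ) ^ (-δ - s - 1) = a) (hX : ε * x = X) (hY : ε * y = Y)
    (hθ : n * y + ω * t = θ) :
    eulerResidual ρ₀ h₀ γ (approxSol ψ φ₁ φ₂ s δ ω n) t x y =
      ![0,
        ((n : ℝ)⁻¹) ^ 2 * ε * (φ₁ X * deriv φ₁ X * (deriv φ₂ Y ^ 2 - φ₂ Y * deriv (deriv φ₂) Y))
        - ω * a * ε * (ψ X * deriv ψ Y * Real.cos θ)
        - ω * a * (n : ℝ)⁻¹ * ε ^ 2 * (ψ X * deriv (deriv ψ) Y * Real.sin θ)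
        + a ^ 2 * ε * n ^ 2 * (ψ X * deriv ψ X * ψ Y ^ 2)
        + a ^ 2 * ε ^ 3 * (ψ X * deriv ψ X *
            (deriv ψ Y ^ 2 - ψ Y * deriv (deriv ψ) Y) * Real.sin θ ^ 2),
        ((n : ℝ)⁻¹) ^ 2 * ε * ((deriv φ₁ X ^ 2 - φ₁ X * deriv (deriv φ₁) X) * (φ₂ Y * deriv φ₂ Y))
        + ω * a * (n : ℝ)⁻¹ * ε ^ 2 * (deriv ψ X * deriv ψ Y * Real.sin θ)
        + a ^ 2 * ε ^ 2 * n * ((deriv ψ X ^ 2 - ψ X * deriv (deriv ψ) X) * ψ Y ^ 2 *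
            (Real.sin θ * Real.cos θ))
        + a ^ 2 * ε ^ 3 * ((deriv ψ X ^ 2 - ψ X * deriv (deriv ψ) X) *
            (ψ Y * deriv ψ Y) * Real.sin θ ^ 2),
        0] := by
  have hψ := hcut.psi_smooth
  have h₁ := hcut.phi_one_smooth
  have h₂ := hcut.phi_two_smooth
  have hψ' := contDiff_deriv hψ
  have h₁' := contDiff_deriv h₁
  have h₂' := contDiff_deriv h₂
  have hU : approxSol ψ φ₁ φ₂ s δ ω n = fun t x y => ![0,
      ω * (n : ℝ)⁻¹ * (φ₁ (ε * x) * deriv φ₂ (ε * y)) +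
        a * (n * (ψ (ε * x) * ψ (ε * y) * Real.cos (n * y + ω * t)) +
          ε * (ψ (ε * x) * deriv ψ (ε * y) * Real.sin (n * y + ω * t))),
      -ω * (n : ℝ)⁻¹ * (deriv φ₁ (ε * x) * φ₂ (ε * y)) +
        -a * (ε * (deriv ψ (ε * x) * ψ (ε * y) * Real.sin (n * y + ω * t))), 0] := by
    funext t x y
    rw [approxSol, uHigh_eq hψ, vHigh_eq hψ, uLow, vLow, hε, ha]
    simp only [mul_assoc]
  have hD {f : ℝ → ℝ} (hf : ContDiff ℝ (⊤ : ℕ∞) f) (z : ℝ) := hasDerivAt_comp_const_mul hf ε z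
  have hs := hasDerivAt_sin_phase (n : ℝ) (ω * t) y
  have hc := hasDerivAt_cos_phase (n : ℝ) (ω * t) y
  have hst := hasDerivAt_sin_phase_add (n * y) ω t
  have hct := hasDerivAt_cos_phase_add (n * y) ω t
  rw [hU, eulerResidual_velocity ρ₀ h₀ γ
    ((((hct.const_mul (ψ (ε * x) * ψ (ε * y))).const_mul (n : ℝ)).add
      ((hst.const_mul (ψ (ε * x) * deriv ψ (ε * y))).const_mul ε)).const_mul a |>.const_add
        (ω * (n : ℝ)⁻¹ * (φ₁ (ε * x) * deriv φ₂ (ε * y))))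
    ((((hD h₁ x).mul_const (deriv φ₂ (ε * y))).const_mul (ω * (n : ℝ)⁻¹)).add
      (((((hD hψ x).mul_const (ψ (ε * y))).mul_const _).const_mul (n : ℝ)).add
        ((((hD hψ x).mul_const (deriv ψ (ε * y))).mul_const _).const_mul ε) |>.const_mul a))
    ((((hD h₂' y).const_mul (φ₁ (ε * x))).const_mul (ω * (n : ℝ)⁻¹)).add
      (((((hD hψ y).const_mul (ψ (ε * x))).mul hc).const_mul (n : ℝ)).add
        ((((hD hψ' y).const_mul (ψ (ε * x))).mul hs).const_mul ε) |>.const_mul a))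
    ((((hst.const_mul (deriv ψ (ε * x) * ψ (ε * y))).const_mul ε).const_mul (-a)).const_add
        (-ω * (n : ℝ)⁻¹ * (deriv φ₁ (ε * x) * φ₂ (ε * y))))
    ((((hD h₁' x).mul_const (φ₂ (ε * y))).const_mul (-ω * (n : ℝ)⁻¹)).add
      (((((hD hψ' x).mul_const (ψ (ε * y))).mul_const _).const_mul ε).const_mul (-a)))
    ((((hD h₂ y).const_mul (deriv φ₁ (ε * x))).const_mul (-ω * (n : ℝ)⁻¹)).add
      (((((hD hψ y).const_mul (deriv ψ (ε * x))).mul hs).const_mul ε).const_mul (-a)))]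
  rw [hX, hY, hθ]
  have hω2 : ω ^ 2 = 1 := by rcases hω with rfl | rfl <;> norm_num
  have hn0 : (n : ℝ) ≠ 0 := by positivity
  have hsc : Real.cos θ ^ 2 = 1 - Real.sin θ ^ 2 := by rw [← Real.sin_sq_add_cos_sq θ]; ring
  have hz : ∀ z ∉ tsupport ψ, ψ z = 0 ∧ deriv ψ z = 0 ∧ deriv (deriv ψ) z = 0 := fun z hz =>
    ⟨image_eq_zero_of_notMem_tsupport hz,
      image_eq_zero_of_notMem_tsupport fun h => hz (tsupport_deriv_subset h),
      image_eq_zero_of_notMem_tsupport fun h =>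
        hz (tsupport_deriv_subset (tsupport_deriv_subset h))⟩
  -- In each variable, either every high frequency factor vanishes or the low frequency cutoff is
  -- flat. This dichotomy eliminates the unwanted cross terms.
  have hx : (ψ X = 0 ∧ deriv ψ X = 0 ∧ deriv (deriv ψ) X = 0) ∨
      (deriv φ₁ X = 1 ∧ deriv (deriv φ₁) X = 0) := by
    by_cases h : X ∈ tsupport ψ
    · exact .inr ⟨hcut.phi_one_eq X h,
        deriv_eq_zero_of_eq_const_on_tsupport hψ.continuous h₁' hcut.phi_one_eq X h⟩
    · exact .inl (hz X h)
  have hy : (ψ Y = 0 ∧ deriv ψ Y = 0 ∧ deriv (deriv ψ) Y = 0) ∨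
      (φ₂ Y = 1 ∧ deriv φ₂ Y = 0 ∧ deriv (deriv φ₂) Y = 0) := by
    by_cases h : Y ∈ tsupport ψ
    · have h0 := deriv_eq_zero_of_eq_const_on_tsupport hψ.continuous h₂ hcut.phi_two_eq
      exact .inr ⟨hcut.phi_two_eq Y h, h0 Y h,
        deriv_eq_zero_of_eq_const_on_tsupport hψ.continuous h₂' h0 Y h⟩
    · exact .inl (hz Y h)
  generalize hN : (n : ℝ)⁻¹ = m
  have hmn : m * n = 1 := by rw [← hN]; field_simp
  generalize (n : ℝ) = N at hmn ⊢
  ext i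
  fin_cases i
  · simp
    ring_nf
    simp
  -- A vanishing combination of `ω² = 1`, `m N = 1` and `cos² + sin² = 1`, with the multipliers by
  -- which the raw residual differs from the claimed form. The `m N` term holds the transport
  -- cancellation.
  · have k : m ^ 2 * ε * (φ₁ X * deriv φ₁ X * (deriv φ₂ Y ^ 2 - φ₂ Y * deriv (deriv φ₂) Y)) *
          (ω ^ 2 - 1) +
        ω * a * (N * ψ X * ψ Y * Real.sin θ - 2 * ε * ψ X * deriv ψ Y * Real.cos θ) * (m * N - 1) +
        a ^ 2 * ε * N ^ 2 * ψ X * deriv ψ X * ψ Y ^ 2 *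
          (Real.cos θ ^ 2 - (1 - Real.sin θ ^ 2)) = 0 := by
      rw [hω2, hmn, hsc]; ring
    simp only [Fin.mk_one, Matrix.cons_val_one, Matrix.cons_val_zero, Fin.isValue]
    rcases hx with ⟨e1, e2, e3⟩ | ⟨e1, e2⟩ <;> rcases hy with ⟨e4, e5, e6⟩ | ⟨e4, e5, e6⟩ <;>
      simp only [e1, e2, e4, e5, e6] at k ⊢ <;> linear_combination k
  · have k : m ^ 2 * ε * ((deriv φ₁ X ^ 2 - φ₁ X * deriv (deriv φ₁) X) * (φ₂ Y * deriv φ₂ Y)) *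
          (ω ^ 2 - 1) + ω * a * ε * deriv ψ X * ψ Y * Real.cos θ * (m * N - 1) = 0 := by
      rw [hω2, hmn]; ring
    simp only [Fin.reduceFinMk, Matrix.cons_val]
    rcases hx with ⟨e1, e2, e3⟩ | ⟨e1, e2⟩ <;> rcases hy with ⟨e4, e5, e6⟩ | ⟨e4, e5, e6⟩
    · simp only [e1, e2, e3, e4, e5] at k ⊢; linear_combination k
    · simp only [e1, e2, e3, e4, e5] at k ⊢; linear_combination k
    · simp only [e1, e2, e4, e5] at k ⊢; linear_combination k
    · simp only [e1, e2, e4, e5] at k ⊢; linear_combination k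
  · simp
    ring_nf
    simp

end Residual

/-! ### Sobolev bounds for the residual components -/

theorem exists_hasSobolevBound_const_mul_tensor_cos {σ : ℝ} (hσ : 0 ≤ σ) {F G : ℝ → ℝ}
    (hF : ContDiff ℝ (⊤ : ℕ∞) F) (hFc : HasCompactSupport F) (hG : ContDiff ℝ (⊤ : ℕ∞) G)
    (hGc : HasCompactSupport G) :
    ∃ K : ℝ, 0 ≤ K ∧ ∀ ε κ θ c b : ℝ, 0 < ε → ε ≤ 1 → |c| * (ε⁻¹ * (1 + |κ|) ^ σ) ≤ b →
      HasSobolevBound σ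
        (fun p => ((c * (F (ε * p 0) * G (ε * p 1) * Real.cos (κ * p 1 + θ)) : ℝ) : ℂ))
        (K * b) := by
  obtain ⟨K, hK, h⟩ := exists_hasSobolevBound_tensor_cos hσ hF hFc hG hGc
  refine ⟨K, hK, fun ε κ θ c b hε hε1 hb => ?_⟩
  have := (h ε κ θ hε hε1).const_mul (c : ℂ) (D := K * b) (by
    rw [Complex.norm_real, Real.norm_eq_abs]
    calc _ = K * (|c| * (ε⁻¹ * (1 + |κ|) ^ σ)) := by ring
      _ ≤ _ := by gcongr)
  simpa only [Complex.ofReal_mul] using this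

theorem HasSobolevBound.congr_ofReal {σ C D : ℝ} {f : Plane → ℂ} {g : Plane → ℝ}
    (hf : HasSobolevBound σ f C) (h : ∀ p, (g p : ℂ) = f p) (hCD : C ≤ D) :
    HasSobolevBound σ (fun p => (g p : ℂ)) D := by
  obtain ⟨F, hF, hC⟩ := hf
  exact ⟨F, fun v => (hF v).trans (h v).symm, hC.trans hCD⟩

/-- The `ε` in the coefficient pays for the dilation. The factor `3 ^ σ` only matches the high
frequency bound. -/
theorem abs_mul_weight_le_of_low {σ ε : ℝ} (hσ : 0 ≤ σ) (hε : 0 < ε) (m : ℝ) :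
    |m ^ 2 * ε| * (ε⁻¹ * (1 + |(0 : ℝ)|) ^ σ) ≤ 3 ^ σ * m ^ 2 := by
  have h3 : (1 : ℝ) ≤ 3 ^ σ := Real.one_le_rpow (by norm_num) hσ
  rw [abs_of_nonneg (by positivity), abs_zero, add_zero, Real.one_rpow]
  calc m ^ 2 * ε * (ε⁻¹ * 1) = 1 * m ^ 2 := by field_simp
    _ ≤ 3 ^ σ * m ^ 2 := by gcongr

/-- The `3` comes from `1 + 2 * N ≤ 3 * N`; frequencies up to `2 * N` occur because products of two
oscillations double the phase. -/
theorem abs_mul_weight_le_of_high {σ ε m N q c κ : ℝ} (hσ : 0 ≤ σ) (hε : 0 < ε) (hN : 1 ≤ N)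
    (hq : q * N ^ σ ≤ m ^ 2) (hc : |c| ≤ ε * q)
    (hκ : |κ| ≤ 2 * N) : |c| * (ε⁻¹ * (1 + |κ|) ^ σ) ≤ 3 ^ σ * m ^ 2 := by
  have h : (1 + |κ|) ^ σ ≤ 3 ^ σ * N ^ σ := by
    rw [← Real.mul_rpow (by norm_num) (by linarith)]
    gcongr
    linarith
  have hεq : 0 ≤ ε * q := (abs_nonneg c).trans hc
  calc |c| * (ε⁻¹ * (1 + |κ|) ^ σ) ≤ (ε * q) * (ε⁻¹ * (3 ^ σ * N ^ σ)) := by gcongr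
    _ = 3 ^ σ * (q * N ^ σ) := by field_simp
    _ ≤ 3 ^ σ * m ^ 2 := by gcongr

section Components

variable {ψ φ₁ φ₂ : ℝ → ℝ}

/-- Each term is a tensor profile times a single cosine after a phase shift or a double angle
formula. The factor `φ₁` lacks compact support but always meets `deriv φ₁`. -/
theorem exists_hasSobolevBound_residual_one (hcut : IsCutoffTriple ψ φ₁ φ₂) {σ : ℝ} (hσ : 0 ≤ σ) :
    ∃ K : ℝ, 0 ≤ K ∧ ∀ N m ε q ω τ : ℝ, 1 ≤ N → m * N = 1 → 0 < ε → ε ≤ 1 → 0 ≤ q →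
      q * N ^ 2 ≤ 1 → q * N ^ σ ≤ m ^ 2 → |ω| = 1 →
      HasSobolevBound σ (fun p : Plane =>
        ((m ^ 2 * ε * (φ₁ (ε * p 0) * deriv φ₁ (ε * p 0) *
            (deriv φ₂ (ε * p 1) ^ 2 - φ₂ (ε * p 1) * deriv (deriv φ₂) (ε * p 1)))
        - ω * (ε * q) * ε * (ψ (ε * p 0) * deriv ψ (ε * p 1) * Real.cos (N * p 1 + τ))
        - ω * (ε * q) * m * ε ^ 2 *
            (ψ (ε * p 0) * deriv (deriv ψ) (ε * p 1) * Real.sin (N * p 1 + τ))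
        + (ε * q) ^ 2 * ε * N ^ 2 * (ψ (ε * p 0) * deriv ψ (ε * p 0) * ψ (ε * p 1) ^ 2)
        + (ε * q) ^ 2 * ε ^ 3 * (ψ (ε * p 0) * deriv ψ (ε * p 0) *
            (deriv ψ (ε * p 1) ^ 2 - ψ (ε * p 1) * deriv (deriv ψ) (ε * p 1)) *
            Real.sin (N * p 1 + τ) ^ 2) : ℝ) : ℂ)) (K * m ^ 2) := by
  have sψ := hcut.psi_smooth
  have sψ' := contDiff_deriv sψ
  have sψ'' := contDiff_deriv sψ'
  have s₁ := hcut.phi_one_smooth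
  have s₁' := contDiff_deriv s₁
  have s₂ := hcut.phi_two_smooth
  have s₂' := contDiff_deriv s₂
  have s₂'' := contDiff_deriv s₂'
  have cψ := hcut.psi_compact
  have cψ' := cψ.deriv
  have c₂ := hcut.phi_two_compact
  have c₂' := c₂.deriv
  have sP : ContDiff ℝ (⊤ : ℕ∞) fun z => ψ z * deriv ψ z := sψ.mul sψ'
  have cP : HasCompactSupport fun z => ψ z * deriv ψ z := cψ.mul_right
  obtain ⟨K₁, h₁, H₁⟩ := exists_hasSobolevBound_const_mul_tensor_cos hσ
    (F := fun z => φ₁ z * deriv φ₁ z) (s₁.mul s₁') hcut.phi_one_compact.mul_left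
    (G := fun z => deriv φ₂ z * deriv φ₂ z - φ₂ z * deriv (deriv φ₂) z)
    ((s₂'.mul s₂').sub (s₂.mul s₂'')) (c₂'.mul_right.sub c₂.mul_right)
  obtain ⟨K₂, h₂, H₂⟩ := exists_hasSobolevBound_const_mul_tensor_cos hσ sψ cψ sψ' cψ'
  obtain ⟨K₃, h₃, H₃⟩ := exists_hasSobolevBound_const_mul_tensor_cos hσ sψ cψ sψ'' cψ'.deriv
  obtain ⟨K₄, h₄, H₄⟩ := exists_hasSobolevBound_const_mul_tensor_cos hσ sP cP
    (G := fun z => ψ z * ψ z) (sψ.mul sψ) cψ.mul_right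
  obtain ⟨K₅, h₅, H₅⟩ := exists_hasSobolevBound_const_mul_tensor_cos hσ sP cP
    (G := fun z => deriv ψ z * deriv ψ z - ψ z * deriv (deriv ψ) z)
    ((sψ'.mul sψ').sub (sψ.mul sψ'')) (cψ'.mul_right.sub cψ.mul_right)
  refine ⟨(K₁ + K₂ + K₃ + K₄ + K₅ + K₅) * 3 ^ σ, by positivity, ?_⟩
  intro N m ε q ω τ hN hmN hε hε1 hq hqN hqσ hω
  have hm : 0 < m := by
    by_contra h
    nlinarith
  have hm1 : m ≤ 1 := by nlinarith
  have hq1 : q ≤ 1 := (le_mul_of_one_le_right hq (one_le_pow₀ hN)).trans hqN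
  have hhigh {c κ : ℝ} := abs_mul_weight_le_of_high (c := c) (κ := κ) hσ hε hN hqσ
  have T₁ := H₁ ε 0 0 _ _ hε hε1 (abs_mul_weight_le_of_low hσ hε m)
  have T₂ := H₂ ε N τ (-(ω * (ε * q) * ε)) _ hε hε1 (hhigh (by
    rw [abs_neg, abs_mul, abs_mul, hω, one_mul, abs_of_nonneg (by positivity), abs_of_pos hε]
    exact mul_le_of_le_one_right (by positivity) hε1)
    (by rw [abs_of_nonneg] <;> linarith))
  -- The shift by `π / 2` turns the sine into a cosine.
  have T₃ := H₃ ε N (τ - Real.pi / 2) (-(ω * (ε * q) * (m * ε ^ 2))) _ hε hε1 (hhigh (by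
    rw [abs_neg, abs_mul, abs_mul, hω, one_mul, abs_of_nonneg (by positivity),
      abs_of_pos (by positivity)]
    exact mul_le_of_le_one_right (by positivity)
      (mul_le_one₀ hm1 (by positivity) (pow_le_one₀ hε.le hε1)))
    (by rw [abs_of_nonneg] <;> linarith))
  have T₄ := H₄ ε 0 0 ((ε * q) * (ε ^ 2 * (q * N ^ 2))) _ hε hε1 (hhigh (by
    rw [abs_of_nonneg (by positivity)]
    exact mul_le_of_le_one_right (by positivity)
      (mul_le_one₀ (pow_le_one₀ hε.le hε1) (by positivity) hqN))
    (by rw [abs_zero]; linarith))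
  -- By `sin² = (1 - cos 2θ) / 2`, the last term splits into frequencies `0` and `2 * N` with the
  -- same profile, which is why `K₅` is counted twice.
  have hc₅ : |(ε * q) * (ε ^ 4 * (q * (1 / 2)))| ≤ ε * q := by
    rw [abs_of_nonneg (by positivity)]
    exact mul_le_of_le_one_right (by positivity)
      (mul_le_one₀ (pow_le_one₀ hε.le hε1) (by positivity) (by linarith))
  have T₅ := H₅ ε 0 0 _ _ hε hε1 (hhigh hc₅ (by rw [abs_zero]; linarith))
  have T₆ := H₅ ε (2 * N) (2 * τ) (-((ε * q) * (ε ^ 4 * (q * (1 / 2))))) _ hε hε1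
    (hhigh (by rwa [abs_neg]) (by rw [abs_of_nonneg] <;> linarith))
  refine (((((T₁.add T₂).add T₃).add T₄).add T₅).add T₆).congr_ofReal (fun p => ?_)
    (le_of_eq (by ring))
  rw [zero_mul, zero_add, Real.cos_zero, ← add_sub_assoc, Real.cos_sub_pi_div_two,
    show 2 * N * p 1 + 2 * τ = 2 * (N * p 1 + τ) by ring, Real.cos_two_mul, Real.cos_sq']
  norm_cast
  ring

theorem exists_hasSobolevBound_residual_two (hcut : IsCutoffTriple ψ φ₁ φ₂) {σ : ℝ} (hσ : 0 ≤ σ) :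
    ∃ K : ℝ, 0 ≤ K ∧ ∀ N m ε q ω τ : ℝ, 1 ≤ N → m * N = 1 → 0 < ε → ε ≤ 1 → 0 ≤ q →
      q * N ^ 2 ≤ 1 → q * N ^ σ ≤ m ^ 2 → |ω| = 1 →
      HasSobolevBound σ (fun p : Plane =>
        ((m ^ 2 * ε * ((deriv φ₁ (ε * p 0) ^ 2 - φ₁ (ε * p 0) * deriv (deriv φ₁) (ε * p 0)) *
            (φ₂ (ε * p 1) * deriv φ₂ (ε * p 1)))
        + ω * (ε * q) * m * ε ^ 2 *
            (deriv ψ (ε * p 0) * deriv ψ (ε * p 1) * Real.sin (N * p 1 + τ))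
        + (ε * q) ^ 2 * ε ^ 2 * N *
            ((deriv ψ (ε * p 0) ^ 2 - ψ (ε * p 0) * deriv (deriv ψ) (ε * p 0)) *
            ψ (ε * p 1) ^ 2 * (Real.sin (N * p 1 + τ) * Real.cos (N * p 1 + τ)))
        + (ε * q) ^ 2 * ε ^ 3 *
            ((deriv ψ (ε * p 0) ^ 2 - ψ (ε * p 0) * deriv (deriv ψ) (ε * p 0)) *
            (ψ (ε * p 1) * deriv ψ (ε * p 1)) * Real.sin (N * p 1 + τ) ^ 2) : ℝ) : ℂ))
        (K * m ^ 2) := by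
  have sψ := hcut.psi_smooth
  have sψ' := contDiff_deriv sψ
  have sψ'' := contDiff_deriv sψ'
  have s₁ := hcut.phi_one_smooth
  have s₁' := contDiff_deriv s₁
  have s₁'' := contDiff_deriv s₁'
  have s₂ := hcut.phi_two_smooth
  have s₂' := contDiff_deriv s₂
  have cψ := hcut.psi_compact
  have cψ' := cψ.deriv
  have c₁' := hcut.phi_one_compact
  have sQ : ContDiff ℝ (⊤ : ℕ∞) fun z => deriv ψ z * deriv ψ z - ψ z * deriv (deriv ψ) z :=
    (sψ'.mul sψ').sub (sψ.mul sψ'')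
  have cQ : HasCompactSupport fun z => deriv ψ z * deriv ψ z - ψ z * deriv (deriv ψ) z :=
    cψ'.mul_right.sub cψ.mul_right
  obtain ⟨K₁, h₁, H₁⟩ := exists_hasSobolevBound_const_mul_tensor_cos hσ
    (F := fun z => deriv φ₁ z * deriv φ₁ z - φ₁ z * deriv (deriv φ₁) z)
    ((s₁'.mul s₁').sub (s₁.mul s₁'')) (c₁'.mul_right.sub c₁'.deriv.mul_left)
    (G := fun z => φ₂ z * deriv φ₂ z) (s₂.mul s₂') hcut.phi_two_compact.mul_right
  obtain ⟨K₂, h₂, H₂⟩ := exists_hasSobolevBound_const_mul_tensor_cos hσ sψ' cψ' sψ' cψ'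
  obtain ⟨K₃, h₃, H₃⟩ := exists_hasSobolevBound_const_mul_tensor_cos hσ sQ cQ
    (G := fun z => ψ z * ψ z) (sψ.mul sψ) cψ.mul_right
  obtain ⟨K₄, h₄, H₄⟩ := exists_hasSobolevBound_const_mul_tensor_cos hσ sQ cQ
    (G := fun z => ψ z * deriv ψ z) (sψ.mul sψ') cψ.mul_right
  refine ⟨(K₁ + K₂ + K₃ + K₄ + K₄) * 3 ^ σ, by positivity, ?_⟩
  intro N m ε q ω τ hN hmN hε hε1 hq hqN hqσ hω
  have hm : 0 < m := by
    by_contra h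
    nlinarith
  have hm1 : m ≤ 1 := by nlinarith
  have hq1 : q ≤ 1 := (le_mul_of_one_le_right hq (one_le_pow₀ hN)).trans hqN
  have hqN1 : q * N ≤ 1 := by nlinarith [mul_nonneg hq (sub_nonneg.2 hN)]
  have hhigh {c κ : ℝ} := abs_mul_weight_le_of_high (c := c) (κ := κ) hσ hε hN hqσ
  have T₁ := H₁ ε 0 0 _ _ hε hε1 (abs_mul_weight_le_of_low hσ hε m)
  have T₂ := H₂ ε N (τ - Real.pi / 2) (ω * (ε * q) * (m * ε ^ 2)) _ hε hε1 (hhigh (by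
    rw [abs_mul, abs_mul, hω, one_mul, abs_of_nonneg (by positivity),
      abs_of_pos (by positivity)]
    exact mul_le_of_le_one_right (by positivity)
      (mul_le_one₀ hm1 (by positivity) (pow_le_one₀ hε.le hε1)))
    (by rw [abs_of_nonneg] <;> linarith))
  -- Here `sin θ cos θ = cos (2θ - π / 2) / 2`.
  have T₃ := H₃ ε (2 * N) (2 * τ - Real.pi / 2) ((ε * q) * (ε ^ 3 * (q * N * (1 / 2)))) _ hε hε1
    (hhigh (by
      rw [abs_of_nonneg (by positivity)]
      exact mul_le_of_le_one_right (by positivity)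
        (mul_le_one₀ (pow_le_one₀ hε.le hε1) (by positivity) (by linarith)))
    (by rw [abs_of_nonneg] <;> linarith))
  have hc₄ : |(ε * q) * (ε ^ 4 * (q * (1 / 2)))| ≤ ε * q := by
    rw [abs_of_nonneg (by positivity)]
    exact mul_le_of_le_one_right (by positivity)
      (mul_le_one₀ (pow_le_one₀ hε.le hε1) (by positivity) (by linarith))
  have T₄ := H₄ ε 0 0 _ _ hε hε1 (hhigh hc₄ (by rw [abs_zero]; linarith))
  have T₅ := H₄ ε (2 * N) (2 * τ) (-((ε * q) * (ε ^ 4 * (q * (1 / 2))))) _ hε hε1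
    (hhigh (by rwa [abs_neg]) (by rw [abs_of_nonneg] <;> linarith))
  refine ((((T₁.add T₂).add T₃).add T₄).add T₅).congr_ofReal (fun p => ?_)
    (le_of_eq (by ring))
  rw [zero_mul, zero_add, Real.cos_zero, ← add_sub_assoc, Real.cos_sub_pi_div_two,
    ← add_sub_assoc, Real.cos_sub_pi_div_two,
    show 2 * N * p 1 + 2 * τ = 2 * (N * p 1 + τ) by ring, Real.cos_two_mul, Real.cos_sq',
    Real.sin_two_mul]
  norm_cast
  ring

end Components

/-! ### Assembly -/

theorem sobolevNormVec_le {σ B C : ℝ} {V : ℝ → ℝ → Fin 4 → ℝ} (hC : 0 ≤ C) (hB : 0 ≤ B)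
    (h0 : ∀ x y, V x y 0 = 0) (h3 : ∀ x y, V x y 3 = 0)
    (h1 : HasSobolevBound σ (fun p => ((V (p 0) (p 1) 1 : ℝ) : ℂ)) B)
    (h2 : HasSobolevBound σ (fun p => ((V (p 0) (p 1) 2 : ℝ) : ℂ)) C) :
    sobolevNormVec σ V ≤ ENNReal.ofReal (B + C) := by
  have hz : sobolevNorm σ (fun _ : Plane => 0) = 0 := by
    simpa using (hasSobolevBound_zero σ).sobolevNorm_le
  have hsum : ∑ i : Fin 4, sobolevNorm σ (fun p : Plane => ((V (p 0) (p 1) i : ℝ) : ℂ)) ^ 2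
      ≤ ENNReal.ofReal (B + C) ^ 2 := by
    simp only [Fin.sum_univ_four, h0, h3, Complex.ofReal_zero, hz]
    calc _ ≤ 0 ^ 2 + ENNReal.ofReal B ^ 2 + ENNReal.ofReal C ^ 2 + 0 ^ 2 := by
          gcongr
          · exact h1.sobolevNorm_le
          · exact h2.sobolevNorm_le
      _ = ENNReal.ofReal (B ^ 2 + C ^ 2) := by
          rw [ENNReal.ofReal_add (by positivity) (by positivity), ENNReal.ofReal_pow hB,
            ENNReal.ofReal_pow hC]
          simp
      _ ≤ ENNReal.ofReal ((B + C) ^ 2) := ENNReal.ofReal_le_ofReal (by nlinarith)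
      _ = _ := ENNReal.ofReal_pow (by positivity) 2
  calc sobolevNormVec σ V ≤ (ENNReal.ofReal (B + C) ^ 2) ^ (1 / 2 : ℝ) :=
        ENNReal.rpow_le_rpow hsum (by norm_num)
    _ = _ := by
        rw [← ENNReal.rpow_natCast, ← ENNReal.rpow_mul]
        norm_num

end GasDynamics

end

theorem mainTheorem4 (ψ φ₁ φ₂ : ℝ → ℝ) (hcut : GasDynamics.IsCutoffTriple ψ φ₁ φ₂)
    (s σ : ℝ) (hs : 2 < s) (hσ : max 1 (s - 2) < σ) (hσs : σ < s - 1) :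
    ∃ C : ℝ, ∀ δ : ℝ, 0 < δ → ∀ ρ₀ h₀ γ : ℝ, 0 < ρ₀ → 0 < h₀ → 1 < γ →
      ∀ ω : ℝ, (ω = 1 ∨ ω = -1) → ∀ n : ℕ, 1 ≤ n → ∀ t : ℝ,
        GasDynamics.sobolevNormVec σ
            (GasDynamics.eulerResidual ρ₀ h₀ γ (GasDynamics.approxSol ψ φ₁ φ₂ s δ ω n) t)
          ≤ ENNReal.ofReal (C * (n : ℝ) ^ (δ - 2)) := by
  have hσ0 : 0 ≤ σ := zero_le_one.trans ((le_max_left _ _).trans hσ.le)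
  obtain ⟨K₁, hK₁, H₁⟩ := GasDynamics.exists_hasSobolevBound_residual_one hcut hσ0
  obtain ⟨K₂, hK₂, H₂⟩ := GasDynamics.exists_hasSobolevBound_residual_two hcut hσ0
  refine ⟨K₁ + K₂, fun δ hδ ρ₀ h₀ γ _ _ _ ω hω n hn t => ?_⟩
  have hN : (1 : ℝ) ≤ n := by exact_mod_cast hn
  have hN0 : (0 : ℝ) < n := by linarith
  set ε : ℝ := (n : ℝ) ^ (-δ) with hε
  set q : ℝ := (n : ℝ) ^ (-s - 1) with hq
  have hε0 : 0 < ε := Real.rpow_pos_of_pos hN0 _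
  have hε1 : ε ≤ 1 := Real.rpow_le_one_of_one_le_of_nonpos hN (by linarith)
  have ha : (n : ℝ) ^ (-δ - s - 1) = ε * q := by
    rw [hε, hq, ← Real.rpow_add hN0]; ring_nf
  have hm2 : ((n : ℝ)⁻¹) ^ 2 = (n : ℝ) ^ (-2 : ℝ) := by
    rw [Real.rpow_neg hN0.le, inv_pow]; norm_num
  have hqN : q * (n : ℝ) ^ 2 ≤ 1 := by
    rw [hq, ← Real.rpow_natCast, ← Real.rpow_add hN0]
    exact Real.rpow_le_one_of_one_le_of_nonpos hN (by push_cast; linarith)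
  -- The exponent condition is `σ - s - 1 ≤ -2`, that is, `σ ≤ s - 1`.
  have hqσ : q * (n : ℝ) ^ σ ≤ ((n : ℝ)⁻¹) ^ 2 := by
    rw [hq, ← Real.rpow_add hN0, hm2]
    exact Real.rpow_le_rpow_of_exponent_le hN (by linarith)
  have hω1 : |ω| = 1 := by rcases hω with rfl | rfl <;> simp
  have hq0 : 0 ≤ q := Real.rpow_nonneg hN0.le _
  have hR := fun x y => GasDynamics.eulerResidual_approxSol hcut s δ ρ₀ h₀ γ hω hn t x y
    hε.symm ha rfl rfl rfl
  have B₁ := H₁ n (n : ℝ)⁻¹ ε q ω (ω * t) hN (inv_mul_cancel₀ hN0.ne') hε0 hε1 hq0 hqN hqσ hω1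
  have B₂ := H₂ n (n : ℝ)⁻¹ ε q ω (ω * t) hN (inv_mul_cancel₀ hN0.ne') hε0 hε1 hq0 hqN hqσ hω1
  refine (GasDynamics.sobolevNormVec_le (B := K₁ * ((n : ℝ)⁻¹) ^ 2) (C := K₂ * ((n : ℝ)⁻¹) ^ 2)
    (by positivity) (by positivity) (fun x y => ?_) (fun x y => ?_) ?_ ?_).trans
    (ENNReal.ofReal_le_ofReal ?_)
  · rw [hR]; rfl
  · rw [hR]; rfl
  · simp only [hR]; exact B₁
  · simp only [hR]; exact B₂
  -- The bound obtained is of order `n⁻²`; enlarging it to `n^(δ-2)` uses `δ > 0`.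
  · rw [← add_mul, hm2]
    gcongr
    linarith
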